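/- Let $k$ be a field and let $\mathcal C$ be a skeletally small triangulated $k$-category with suspension $\Sigma$ which is Hom-finite (all $\operatorname{Hom}_{\mathcal C}(X,Y)$ are finite dimensional over $k$), Krull–Schmidt (every object is a finite direct sum of objects with local endomorphism rings), and has Serre duality (an autoequivalence $\nu$ of $\mathcal C$ with $k$-linear isomorphisms $\operatorname{Hom}_{\mathcal C}(X,Y)\cong \operatorname{Hom}_k(\operatorname{Hom}_{\mathcal C}(Y,\nu X),k)$ natural in $X$ and $Y$). Let $T$ be a rigid object of $\mathcal C$, i.e. $\operatorname{Hom}_{\mathcal C}(T,\Sigma T)=0$, and let $\mathcal X_T$ be the class of objects $X$ with $\operatorname{Hom}_{\mathcal C}(T,X)=0$. Let $\mathcal C/\mathcal X_T$ be the quotient of $\mathcal C$ by the morphisms factoring through an object of $\mathcal X_T$, let $\mathcal R$ be the class of regular morphisms of $\mathcal C/\mathcal X_T$ (those that are both monomorphisms and epimorphisms), and let $(\mathcal C/\mathcal X_T)_{\mathcal R}$ be the Gabriel–Zisman localisation of $\mathcal C/\mathcal X_T$ at $\mathcal R$. Then: 1. $\mathcal R$ admits a calculus of left fractions and a calculus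 of right fractions; in particular $(\mathcal C/\mathcal X_T)_{\mathcal R}$ inherits from $\mathcal C/\mathcal X_T$ a $k$-linear additive structure for which the localisation functor is $k$-linear. 2. $T$ is a projective generator of $(\mathcal C/\mathcal X_T)_{\mathcal R}$: it is projective there, and every object is a quotient of a finite direct sum of copies of $T$. Moreover the canonical ring homomorphism $\operatorname{End}_{\mathcal C}(T)\to\operatorname{End}_{(\mathcal C/\mathcal X_T)_{\mathcal R}}(T)$ is an isomorphism. 3. The functor $\operatorname{Hom}_{(\mathcal C/\mathcal X_T)_{\mathcal R}}(T,-)$, where $\operatorname{End}_{\mathcal C}(T)^{\mathrm{op}}$ acts by precomposition, takes values in the category $\operatorname{mod}\operatorname{End}_{\mathcal C}(T)^{\mathrm{op}}$ of left $\operatorname{End}_{\mathcal C}(T)^{\mathrm{op}}$-modules that are finite dimensional over $k$, and it is a $k$-linear equivalence $$(\mathcal C/\mathcal X_T)_{\mathcal R}\simeq\operatorname{mod}\operatorname{End}_{\mathcal C}(T)^{\mathrm{op}}.$$ -/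

import Mathlib

open CategoryTheory CategoryTheory.Limits
open scoped ZeroObject

universe w v u v' u'

namespace RigidLoc

section Assumptions

variable (k : Type w) [Field k] (C : Type u) [Category.{v} C] [Preadditive C]

/-- All morphism spaces are finite dimensional over `k`. -/
def IsHomFinite [Linear k C] : Prop :=
  ∀ X Y : C, FiniteDimensional k (X ⟶ Y)

/-- Every object is a finite direct sum (biproduct) of objects with local endomorphism rings. -/
def IsKrullSchmidt : Prop :=
  ∀ X : C, ∃ (n : ℕ) (Y : Fin n → C) (b : Bicone Y),
    Nonempty b.IsBilimit ∧ Nonempty (b.pt ≅ X) ∧ ∀ i, IsLocalRing (End (Y i))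

/-- A Serre duality: an autoequivalence `ν` of `C` with `k`-linear isomorphisms
`Hom(X, Y) ≃ D Hom(Y, ν X)`, natural in `X` and in `Y`, where `D = Hom_k(-, k)`. -/
structure SerreDuality [Linear k C] where
  /-- the Serre functor -/
  ν : C ≌ C
  /-- the duality isomorphisms -/
  iso (X Y : C) : (X ⟶ Y) ≃ₗ[k] Module.Dual k (Y ⟶ ν.functor.obj X)
  naturality_left {X' X Y : C} (f : X' ⟶ X) (g : X ⟶ Y) (h : Y ⟶ ν.functor.obj X') :
    iso X' Y (f ≫ g) h = iso X Y g (h ≫ ν.functor.map f)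
  naturality_right {X Y Y' : C} (g : X ⟶ Y) (f : Y ⟶ Y') (h : Y' ⟶ ν.functor.obj X) :
    iso X Y' (g ≫ f) h = iso X Y g (f ≫ h)

end Assumptions

/-- `T` is rigid: `Ext¹(T, T) = Hom(T, ΣT) = 0`. -/
def IsRigid {C : Type u} [Category.{v} C] [Preadditive C] [HasShift C ℤ] (T : C) : Prop :=
  ∀ f : T ⟶ T⟦(1 : ℤ)⟧, f = 0

section Quotient

variable {C : Type u} [Category.{v} C] [Preadditive C]

/-- The class `𝒳_T` of the objects `X` with `Hom(T, X) = 0`. -/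
def homKernel (T : C) : ObjectProperty C :=
  fun X => ∀ f : T ⟶ X, f = 0

/-- Two parallel morphisms are identified when their difference factors through an object
of `𝒳_T`. -/
def factorRel (T : C) : HomRel C :=
  fun X Y f g => ∃ (Z : C) (_ : homKernel T Z) (a : X ⟶ Z) (b : Z ⟶ Y), f - g = a ≫ b

variable (T : C)

lemma factorRel_add [HasBinaryBiproducts C] ⦃X Y : C⦄ (f₁ f₂ g₁ g₂ : X ⟶ Y) (hf : factorRel T f₁ f₂)
    (hg : factorRel T g₁ g₂) : factorRel T (f₁ + g₁) (f₂ + g₂) := by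
  obtain ⟨Z, hZ, a, b, h⟩ := hf
  obtain ⟨Z', hZ', a', b', h'⟩ := hg
  refine ⟨Z ⊞ Z', fun t => ?_, biprod.lift a a', biprod.desc b b', ?_⟩
  · apply biprod.hom_ext
    · rw [hZ (t ≫ biprod.fst), zero_comp]
    · rw [hZ' (t ≫ biprod.snd), zero_comp]
  · rw [biprod.lift_desc, ← h, ← h']
    abel

lemma factorRel_refl [HasZeroObject C] {X Y : C} (f : X ⟶ Y) : factorRel T f f := by
  refine ⟨(0 : C), fun t => ?_, 0, 0, by simp⟩
  exact (isZero_zero C).eq_of_tgt _ _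

lemma factorRel_smul (k : Type w) [Field k] [Linear k C] (c : k) ⦃X Y : C⦄ (f g : X ⟶ Y) (h : factorRel T f g) :
    factorRel T (c • f) (c • g) := by
  obtain ⟨Z, hZ, a, b, h⟩ := h
  exact ⟨Z, hZ, c • a, b, by rw [← smul_sub, h, Linear.smul_comp]⟩

variable [HasZeroObject C] [HasBinaryBiproducts C]

instance factorRel_congruence : Congruence (factorRel T) where
  comp_left := by
    rintro X Y Z f g g' ⟨W, hW, a, b, h⟩
    exact ⟨W, hW, f ≫ a, b, by rw [← Preadditive.comp_sub, h, Category.assoc]⟩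
  comp_right := by
    rintro X Y Z f f' g ⟨W, hW, a, b, h⟩
    exact ⟨W, hW, a, b ≫ g, by rw [← Preadditive.sub_comp, h, Category.assoc]⟩
  equivalence := by
    intro X Y
    refine ⟨factorRel_refl T, ?_, ?_⟩
    · rintro f g ⟨W, hW, a, b, h⟩
      exact ⟨W, hW, -a, b, by rw [Preadditive.neg_comp, ← h]; abel⟩
    · intro f g h h₁ h₂
      obtain ⟨W, hW, a, b, e⟩ := factorRel_add T _ _ _ _ h₁ h₂
      exact ⟨W, hW, a, b, by rw [← e]; abel⟩

/-- The additive quotient `C/𝒳_T`: same objects as `C`, morphisms modulo those that factor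
through an object of `𝒳_T`. -/
abbrev QuotientCat : Type u := CategoryTheory.Quotient (factorRel T)

/-- The projection functor `C ⥤ C/𝒳_T`. -/
abbrev proj : C ⥤ QuotientCat T := CategoryTheory.Quotient.functor (factorRel T)

instance quotientPreadditive : Preadditive (QuotientCat T) :=
  CategoryTheory.Quotient.preadditive (factorRel T) (factorRel_add T)

instance proj_additive : (proj T).Additive :=
  CategoryTheory.Quotient.functor_additive (factorRel T) (factorRel_add T)

variable (k : Type w) [Field k] [Linear k C]

instance quotientLinear : Linear k (QuotientCat T) :=
  CategoryTheory.Quotient.linear k (factorRel T) (factorRel_smul T k)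

instance proj_linear : (proj T).Linear k :=
  CategoryTheory.Quotient.linear_functor k (factorRel T) (factorRel_smul T k)

end Quotient

/-- The class of regular morphisms: those that are both monomorphisms and epimorphisms. -/
def regularMorphisms (A : Type u) [Category.{v} A] : MorphismProperty A :=
  fun _ _ f => Mono f ∧ Epi f

section Localisation

variable {C : Type u} [Category.{v} C] [Preadditive C] [HasZeroObject C]
  [HasBinaryBiproducts C] (T : C)

/-- The class `ℛ` of regular morphisms of `C/𝒳_T`. -/
abbrev regular : MorphismProperty (QuotientCat T) := regularMorphisms (QuotientCat T)

/-- The Gabriel-Zisman localisation `(C/𝒳_T)_ℛ`. When `ℛ` admits a calculus of left fractions,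
Mathlib endows it with the additive and `k`-linear structures for which the localisation functor
is additive and `k`-linear. -/
noncomputable abbrev LocCat : Type u := (regular T).Localization

/-- The canonical functor `C ⥤ C/𝒳_T ⥤ (C/𝒳_T)_ℛ`. -/
noncomputable abbrev toLoc : C ⥤ LocCat T := proj T ⋙ (regular T).Q

end Localisation

section Modules

variable {C : Type u} [Category.{v} C] [Preadditive C] {E : Type u'} [Category.{v'} E]
  [Preadditive E]

/-- The ring homomorphism `End(T) → End(F T)` induced by an additive functor `F`. -/
def mapEndRingHom (F : C ⥤ E) [F.Additive] (T : C) : End T →+* End (F.obj T) where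
  __ := F.mapEnd T
  map_zero' := F.map_zero T T
  map_add' := fun _ _ => F.map_add

/-- The functor `Hom_E(F T, -)` with values in the category of left modules over `End(T)ᵒᵖ`,
which acts on `Hom_E(F T, Y)` through `F` by precomposition. -/
noncomputable def homFunctor (F : C ⥤ E) [F.Additive] (T : C) : E ⥤ ModuleCat.{v'} (End T)ᵐᵒᵖ :=
  preadditiveCoyonedaObj (F.obj T) ⋙ ModuleCat.restrictScalars (mapEndRingHom F T).op

variable (k : Type w) [Field k]

/-- The modules over a `k`-algebra `Γ` which are finite dimensional over `k`. -/
def isFinDim (Γ : Type v) [Ring Γ] [Algebra k Γ] : ObjectProperty (ModuleCat.{v'} Γ) :=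
  fun M => letI : Module k M := ModuleCat.moduleOfAlgebraModule M
    FiniteDimensional k M

/-- The category `mod Γ` of finite dimensional (left) modules over a `k`-algebra `Γ`. -/
abbrev FinMod (Γ : Type v) [Ring Γ] [Algebra k Γ] : Type (max v (v' + 1)) :=
  (isFinDim.{w, v, v'} k Γ).FullSubcategory

/-- The functor `Hom_E(F T, -)` regarded as a functor to `mod End(T)ᵒᵖ`, when its values are
finite dimensional over `k`. -/
noncomputable abbrev homFunctorFin [Linear k C] (F : C ⥤ E) [F.Additive] (T : C)
    (h : ∀ Y : E, isFinDim k (End T)ᵐᵒᵖ ((homFunctor F T).obj Y)) :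
    E ⥤ FinMod.{w, v, v'} k (End T)ᵐᵒᵖ :=
  (isFinDim k (End T)ᵐᵒᵖ).lift (homFunctor F T) h

end Modules

/-- `P` is a projective generator of `E`: it is projective, and every object is a quotient
of a finite direct sum of copies of `P`. -/
structure IsProjectiveGenerator {E : Type u} [Category.{v} E] [Preadditive E] (P : E) : Prop where
  projective : Projective P
  exists_epi (X : E) : ∃ (n : ℕ) (b : Bicone (fun _ : Fin n => P)) (π : b.pt ⟶ X),
    Nonempty b.IsBilimit ∧ Epi π

end RigidLoc

open RigidLoc

/-! Let `T` be rigid. If `X` is the cone of a morphism `Tᵐ ⟶ Tⁿ`, then applying `Hom(T, -)` to the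
triangle gives a free presentation of the `End(T)ᵒᵖ`-module `Hom(T, X)`, so every module map
`Hom(T, X) ⟶ Hom(T, Y)` comes from a morphism `X ⟶ Y`, and every finitely presented module is of
the form `Hom(T, X)`. As all modules `Hom(T, X)` are finitely generated, approximating twice by
copies of `T` yields for every object a morphism from such a cone which `Hom(T, -)` inverts.

It follows that morphisms are identified in `C/𝒳_T` exactly when `Hom(T, -)` identifies them, and
that the regular morphisms are those inverted by `Hom(T, -)`. Lifting from cones then gives the
right Ore condition. By Serre duality, `Hom(T, -)` and `Hom(-, νT)` identify the same morphisms and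
invert the same morphisms, and `νT` is rigid, so the left Ore condition is the right one for the
object `νT` of `Cᵒᵖ`. In the localisation every object becomes isomorphic to a cone as above, on
which `Hom(T, -)` is full; it is faithful because a fraction killed by `Hom(T, -)` has a numerator
killed by `Hom(T, -)`. -/

namespace RigidLoc

open Opposite Pretriangulated Pretriangulated.Opposite

section Postcomp

variable {C : Type u} [Category.{v} C] [Preadditive C]

/-- The map `Hom(T, f) : Hom(T, X) → Hom(T, Y)`, as a morphism of `End(T)ᵒᵖ`-modules. -/
def postcomp (T : C) {X Y : C} (f : X ⟶ Y) : (T ⟶ X) →ₗ[(End T)ᵐᵒᵖ] (T ⟶ Y) where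
  toFun t := t ≫ f
  map_add' _ _ := Preadditive.add_comp _ _ _ _ _ _
  map_smul' _ _ := Category.assoc _ _ _

@[simp]
lemma postcomp_apply (T : C) {X Y : C} (f : X ⟶ Y) (t : T ⟶ X) : postcomp T f t = t ≫ f :=
  rfl

lemma postcomp_comp (T : C) {X Y Z : C} (f : X ⟶ Y) (g : Y ⟶ Z) :
    postcomp T (f ≫ g) = postcomp T g ∘ₗ postcomp T f :=
  LinearMap.ext fun _ => (Category.assoc _ _ _).symm

lemma postcomp_zero (T X Y : C) : postcomp T (0 : X ⟶ Y) = 0 :=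
  LinearMap.ext fun _ => comp_zero

lemma postcomp_sub (T : C) {X Y : C} (f g : X ⟶ Y) :
    postcomp T (f - g) = postcomp T f - postcomp T g :=
  LinearMap.ext fun t => Preadditive.comp_sub t f g

lemma postcomp_injective (T X : C) : Function.Injective (postcomp T : (T ⟶ X) → _) :=
  fun f g h => by simpa using LinearMap.congr_fun h (𝟙 T)

instance isScalarTower_hom (k : Type w) [Field k] [Linear k C] (T X : C) :
    IsScalarTower k (End T)ᵐᵒᵖ (T ⟶ X) where
  smul_assoc c e t := Linear.smul_comp T T X c e.unop t

lemma moduleFinite_hom (k : Type w) [Field k] [Linear k C] (T X : C)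
    [FiniteDimensional k (T ⟶ X)] : Module.Finite (End T)ᵐᵒᵖ (T ⟶ X) :=
  Module.Finite.of_restrictScalars_finite k _ _

end Postcomp

section Copies

variable {C : Type u} [Category.{v} C] [Preadditive C] [HasFiniteBiproducts C]

/-- The direct sum `Tⁿ`. -/
noncomputable abbrev copies (T : C) (n : ℕ) : C := ⨁ fun _ : Fin n => T

/-- `Hom(T, Tⁿ)` is free of rank `n` over `End(T)ᵒᵖ`. -/
noncomputable def homCopiesEquiv (T : C) (n : ℕ) :
    (T ⟶ copies T n) ≃ₗ[(End T)ᵐᵒᵖ] (Fin n → (End T)ᵐᵒᵖ) where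
  toFun t i := MulOpposite.op (t ≫ biproduct.π _ i : T ⟶ T)
  map_add' s t := by
    ext i
    exact congrArg MulOpposite.op (Preadditive.add_comp _ _ _ s t _)
  map_smul' e t := by
    ext i
    exact congrArg MulOpposite.op (Category.assoc _ _ _)
  invFun a := biproduct.lift fun i => (a i).unop
  left_inv t := by
    ext i
    simp
  right_inv a := by
    ext i
    simp

lemma homCopiesEquiv_symm_single (T : C) (n : ℕ) (i : Fin n) :
    (homCopiesEquiv T n).symm (Pi.single i 1) = biproduct.ι (fun _ : Fin n => T) i := by
  rw [LinearEquiv.symm_apply_eq]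
  ext j
  obtain rfl | hij := eq_or_ne i j
  · rw [Pi.single_eq_same]
    exact congrArg MulOpposite.op (biproduct.ι_π_self (fun _ : Fin n => T) i).symm
  · rw [Pi.single_eq_of_ne' hij]
    exact congrArg MulOpposite.op (biproduct.ι_π_ne (fun _ : Fin n => T) hij).symm

lemma postcomp_copies_bijective (T : C) (n : ℕ) (Y : C) :
    Function.Bijective (postcomp T : (copies T n ⟶ Y) → _) := by
  constructor
  · intro f g h
    ext i
    exact LinearMap.congr_fun h (biproduct.ι (fun _ : Fin n => T) i)
  · intro ψ
    refine ⟨biproduct.desc fun i => ψ (biproduct.ι (fun _ : Fin n => T) i), ?_⟩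
    refine (LinearMap.cancel_right (homCopiesEquiv T n).symm.surjective).1
      ((Pi.basisFun _ _).ext fun i => ?_)
    rw [Pi.basisFun_apply, LinearMap.comp_apply, LinearMap.comp_apply, LinearEquiv.coe_coe,
      homCopiesEquiv_symm_single, postcomp_apply, biproduct.ι_desc]

lemma exists_surjective_postcomp (T X : C) [Module.Finite (End T)ᵐᵒᵖ (T ⟶ X)] :
    ∃ (n : ℕ) (u : copies T n ⟶ X), Function.Surjective (postcomp T u) := by
  obtain ⟨n, f, hf⟩ := Module.Finite.exists_fin' (End T)ᵐᵒᵖ (T ⟶ X)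
  obtain ⟨u, hu⟩ := (postcomp_copies_bijective T n X).2 (f ∘ₗ (homCopiesEquiv T n).toLinearMap)
  exact ⟨n, u, hu ▸ hf.comp (homCopiesEquiv T n).surjective⟩

end Copies

section Triangulated

variable {C : Type u} [Category.{v} C] [Preadditive C] [HasZeroObject C] [HasShift C ℤ]
  [∀ n : ℤ, (shiftFunctor C n).Additive] [Pretriangulated C] {T : C}

lemma IsRigid.eq_zero (hT : IsRigid T) {n : ℕ} (f : T ⟶ (copies T n)⟦(1 : ℤ)⟧) : f = 0 := by
  rw [← cancel_mono ((shiftFunctor C (1 : ℤ)).mapBiproduct fun _ : Fin n => T).hom]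
  ext i
  rw [hT ((f ≫ _) ≫ _), zero_comp, zero_comp]

lemma exact_postcomp (T : C) {X Y Z : C} {u : X ⟶ Y} {p : Y ⟶ Z} {δ : Z ⟶ X⟦(1 : ℤ)⟧}
    (h : Triangle.mk u p δ ∈ distTriang C) : Function.Exact (postcomp T u) (postcomp T p) := by
  intro t
  constructor
  · intro ht
    obtain ⟨t', ht'⟩ := Triangle.coyoneda_exact₂ _ h t ht
    exact ⟨t', ht'.symm⟩
  · rintro ⟨t', rfl⟩
    have hup : u ≫ p = 0 := comp_distTriang_mor_zero₁₂ _ h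
    rw [← LinearMap.comp_apply, ← postcomp_comp, hup, postcomp_zero, LinearMap.zero_apply]

lemma IsRigid.postcomp_surjective (hT : IsRigid T) {m : ℕ} {Y X : C} {u : copies T m ⟶ Y}
    {p : Y ⟶ X} {δ : X ⟶ (copies T m)⟦(1 : ℤ)⟧} (h : Triangle.mk u p δ ∈ distTriang C) :
    Function.Surjective (postcomp T p) := by
  intro t
  obtain ⟨t', ht'⟩ := Triangle.coyoneda_exact₃ _ h t (hT.eq_zero _)
  exact ⟨t', ht'.symm⟩

lemma homKernel_of_surjective_postcomp (hT : IsRigid T) {n : ℕ} {X V : C} {u : copies T n ⟶ X}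
    (hu : Function.Surjective (postcomp T u)) {a : X ⟶ V} {b : V ⟶ (copies T n)⟦(1 : ℤ)⟧}
    (h : Triangle.mk u a b ∈ distTriang C) : homKernel T V := by
  intro t
  obtain ⟨t', rfl⟩ := hT.postcomp_surjective h t
  exact (exact_postcomp T h t').2 (hu t')

lemma factorRel_iff [∀ X : C, Module.Finite (End T)ᵐᵒᵖ (T ⟶ X)] (hT : IsRigid T) {X Y : C}
    (f g : X ⟶ Y) : factorRel T f g ↔ postcomp T f = postcomp T g := by
  constructor
  · rintro ⟨Z, hZ, a, b, h⟩
    rw [← sub_eq_zero, ← postcomp_sub, h]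
    ext t
    rw [postcomp_apply, ← Category.assoc, hZ (t ≫ a), zero_comp, LinearMap.zero_apply]
  · intro h
    obtain ⟨n, u, hu⟩ := exists_surjective_postcomp T X
    obtain ⟨V, a, b, hV⟩ := distinguished_cocone_triangle u
    have hfg : u ≫ (f - g) = 0 := by
      apply (postcomp_copies_bijective T _ _).1
      rw [postcomp_comp, postcomp_sub, h, sub_self, LinearMap.zero_comp, postcomp_zero]
    obtain ⟨c, hc⟩ := Triangle.yoneda_exact₂ _ hV (f - g) hfg
    exact ⟨V, homKernel_of_surjective_postcomp hT hu hV, a, c, hc⟩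

/-- `X` is the cone of a morphism between finite direct sums of copies of `T`. For rigid `T`, such
a triangle is turned by `Hom(T, -)` into a free presentation of the module `Hom(T, X)`. -/
def IsPresentedBy (T X : C) : Prop :=
  ∃ (m n : ℕ) (u : copies T m ⟶ copies T n) (p : copies T n ⟶ X)
    (δ : X ⟶ (copies T m)⟦(1 : ℤ)⟧), Triangle.mk u p δ ∈ distTriang C

lemma IsPresentedBy.postcomp_surjective {X : C} (hX : IsPresentedBy T X) (hT : IsRigid T) (Y : C) :
    Function.Surjective (postcomp T : (X ⟶ Y) → _) := by
  intro ψ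
  obtain ⟨m, n, u, p, δ, h⟩ := hX
  obtain ⟨q, hq⟩ := (postcomp_copies_bijective T n Y).2 (ψ ∘ₗ postcomp T p)
  have huq : u ≫ q = 0 := by
    apply (postcomp_copies_bijective T _ _).1
    rw [postcomp_comp, hq, LinearMap.comp_assoc, (exact_postcomp T h).linearMap_comp_eq_zero,
      LinearMap.comp_zero, postcomp_zero]
  obtain ⟨g, hg⟩ : ∃ g : X ⟶ Y, q = p ≫ g := Triangle.yoneda_exact₂ _ h q huq
  refine ⟨g, (LinearMap.cancel_right (hT.postcomp_surjective h)).1 ?_⟩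
  rw [← postcomp_comp, ← hg, hq]

/-- `X'` is the cone of `Tᵐ ⟶ U ⟶ Tⁿ`, where `U` is the fibre of a map `Tⁿ ⟶ X` and both
`Tⁿ ⟶ X` and `Tᵐ ⟶ U` are surjective on `Hom(T, -)`. -/
lemma exists_presentedBy_resolution [∀ X : C, Module.Finite (End T)ᵐᵒᵖ (T ⟶ X)] (hT : IsRigid T)
    (X : C) : ∃ (X' : C) (s : X' ⟶ X), IsPresentedBy T X' ∧ Function.Bijective (postcomp T s) := by
  obtain ⟨n, p, hp⟩ := exists_surjective_postcomp T X
  obtain ⟨U, a, b, hU⟩ := distinguished_cocone_triangle₁ p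
  obtain ⟨m, c, hc⟩ := exists_surjective_postcomp T U
  obtain ⟨X', p', δ, hX'⟩ := distinguished_cocone_triangle (c ≫ a)
  obtain ⟨s, hs⟩ : ∃ s : X' ⟶ X, p' ≫ s = p := by
    obtain ⟨s, hs, -⟩ := complete_distinguished_triangle_morphism _ _ hX' hU c (𝟙 _)
      (Category.comp_id _)
    exact ⟨s, hs.trans (Category.id_comp _)⟩
  refine ⟨X', s, ⟨m, n, _, _, _, hX'⟩, ?_, ?_⟩
  · rw [injective_iff_map_eq_zero]
    intro t ht
    obtain ⟨t, rfl⟩ := hT.postcomp_surjective hX' t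
    rw [← LinearMap.comp_apply, ← postcomp_comp, hs] at ht
    obtain ⟨r, rfl⟩ := (exact_postcomp T hU t).1 ht
    obtain ⟨r, rfl⟩ := hc r
    exact (exact_postcomp T hX' _).2 ⟨r, by rw [postcomp_comp, LinearMap.comp_apply]⟩
  · rw [← hs, postcomp_comp] at hp
    exact Function.Surjective.of_comp (g := postcomp T p') hp

lemma IsPresentedBy.exists_lift {X : C} (hX : IsPresentedBy T X) (hT : IsRigid T) {Y Y' : C}
    {s : Y ⟶ Y'} (hs : Function.Bijective (postcomp T s)) (f : X ⟶ Y') :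
    ∃ g : X ⟶ Y, postcomp T (g ≫ s) = postcomp T f := by
  let e := LinearEquiv.ofBijective (postcomp T s) hs
  obtain ⟨g, hg⟩ := hX.postcomp_surjective hT Y (e.symm.toLinearMap ∘ₗ postcomp T f)
  refine ⟨g, LinearMap.ext fun t => ?_⟩
  rw [postcomp_comp, hg]
  exact e.apply_symm_apply _

lemma exists_ore_square [∀ X : C, Module.Finite (End T)ᵐᵒᵖ (T ⟶ X)] (hT : IsRigid T)
    {X Y Y' : C} {s : Y ⟶ Y'} (hs : Function.Bijective (postcomp T s)) (f : X ⟶ Y') :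
    ∃ (X' : C) (r : X' ⟶ X) (g : X' ⟶ Y), Function.Bijective (postcomp T r) ∧
      postcomp T (r ≫ f) = postcomp T (g ≫ s) := by
  obtain ⟨X', r, hX', hr⟩ := exists_presentedBy_resolution hT X
  obtain ⟨g, hg⟩ := hX'.exists_lift hT hs (r ≫ f)
  exact ⟨X', r, g, hr, hg.symm⟩

lemma exists_linearEquiv_hom (hT : IsRigid T) (M : Type v') [AddCommGroup M]
    [Module (End T)ᵐᵒᵖ M] [Module.FinitePresentation (End T)ᵐᵒᵖ M] :
    ∃ X : C, Nonempty ((T ⟶ X) ≃ₗ[(End T)ᵐᵒᵖ] M) := by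
  obtain ⟨n, m, f, g, hf, hgf⟩ := Module.FinitePresentation.exists_fin' (End T)ᵐᵒᵖ M
  let em := homCopiesEquiv T m
  let en := homCopiesEquiv T n
  obtain ⟨u, hu⟩ := (postcomp_copies_bijective T m (copies T n)).2
    (en.symm.toLinearMap ∘ₗ g ∘ₗ em.toLinearMap)
  obtain ⟨X, p, δ, hX⟩ := distinguished_cocone_triangle u
  have hθ : Function.Exact (postcomp T u) (f ∘ₗ en.toLinearMap) := by
    rw [hu]
    exact (Function.Exact.of_ladder_linearEquiv_of_exact (e₁ := em.symm) (e₂ := en.symm)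
      (e₃ := .refl _ _) (by ext; simp) (by ext; simp) hgf)
  exact ⟨X, ⟨((exact_postcomp T hX).linearEquivOfSurjective (hT.postcomp_surjective hX)).symm ≪≫ₗ
    hθ.linearEquivOfSurjective (hf.comp en.surjective)⟩⟩

end Triangulated

section Opposite

variable (k : Type w) [Field k] {C : Type u} [Category.{v} C] [Preadditive C] [Linear k C]

instance oppositeLinear : Linear k Cᵒᵖ where
  homModule X Y :=
    letI : SMul k (X ⟶ Y) := ⟨fun c f => (c • f.unop).op⟩
    Function.Injective.module k (unopHom X Y) Quiver.Hom.unop_inj fun _ _ => rfl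
  smul_comp _ _ _ c f g := Quiver.Hom.unop_inj (Linear.comp_smul _ _ _ g.unop c f.unop)
  comp_smul _ _ _ f c g := Quiver.Hom.unop_inj (Linear.smul_comp _ _ _ c g.unop f.unop)

/-- The linear equivalence `f ↦ f.op`. -/
def opLinearEquiv (X Y : C) : (X ⟶ Y) ≃ₗ[k] (op Y ⟶ op X) where
  toFun := Quiver.Hom.op
  map_add' _ _ := rfl
  map_smul' _ _ := rfl
  invFun := Quiver.Hom.unop

end Opposite

section Serre

variable {k : Type w} [Field k] {C : Type u} [Category.{v} C] [Preadditive C] [Linear k C]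
  {T S : C}

/-- The pairing `(t, h) ↦ τ (t ≫ h)` of `Hom(T, Y)` with `Hom(Y, S)`. -/
def serrePairing (τ : Module.Dual k (T ⟶ S)) (Y : C) : (T ⟶ Y) →ₗ[k] Module.Dual k (Y ⟶ S) :=
  (Linear.comp T Y S).compr₂ τ

/-- The form `τ` represents the functor dual to `Hom(T, -)`: composition followed by `τ`
identifies `Hom(T, Y)` with the dual of `Hom(Y, S)`. It is the form that a Serre duality attaches
to the identity of `T`, with `S = ν T`. -/
def IsSerreTrace (τ : Module.Dual k (T ⟶ S)) : Prop :=
  ∀ Y : C, Function.Bijective (serrePairing τ Y)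

lemma SerreDuality.isSerreTrace (D : SerreDuality k C) (T : C) :
    IsSerreTrace (D.iso T T (𝟙 T)) := by
  intro Y
  have h : serrePairing (D.iso T T (𝟙 T)) Y = D.iso T Y := by
    ext t h
    exact (D.naturality_right (𝟙 T) t h).symm.trans (by rw [Category.id_comp]; rfl)
  exact h ▸ (D.iso T Y).bijective

namespace IsSerreTrace

variable {τ : Module.Dual k (T ⟶ S)} (hτ : IsSerreTrace τ)

include hτ

lemma finiteDimensional_hom_op {Y : C} [FiniteDimensional k (T ⟶ Y)] :
    FiniteDimensional k (op S ⟶ op Y) := by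
  have : Module.Finite k (Module.Dual k (Y ⟶ S)) :=
    Module.Finite.equiv (LinearEquiv.ofBijective _ (hτ Y))
  have : FiniteDimensional k (Y ⟶ S) := Module.finite_dual_iff k |>.1 this
  exact Module.Finite.equiv (opLinearEquiv k Y S)

lemma homKernel_iff_op {Y : C} : homKernel T Y ↔ homKernel (op S) (op Y) := by
  have h : Subsingleton (T ⟶ Y) ↔ Subsingleton (op S ⟶ op Y) := by
    rw [(LinearEquiv.ofBijective _ (hτ Y)).toEquiv.subsingleton_congr,
      (opLinearEquiv k Y S).symm.toEquiv.subsingleton_congr]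
    exact Module.subsingleton_dual_iff k
  exact subsingleton_iff_forall_eq 0 |>.symm.trans (h.trans (subsingleton_iff_forall_eq 0))

lemma bijective_postcomp_iff_op {X Y : C} (f : X ⟶ Y) :
    Function.Bijective (postcomp T f) ↔ Function.Bijective (postcomp (op S) f.op) := by
  let f' : (Y ⟶ S) →ₗ[k] (X ⟶ S) := Linear.leftComp k S f
  have hf : serrePairing τ Y ∘ postcomp T f = f'.dualMap ∘ serrePairing τ X := by
    funext t
    ext h
    exact congrArg τ (Category.assoc _ _ _)
  have hf' : opLinearEquiv k X S ∘ f' = postcomp (op S) f.op ∘ opLinearEquiv k Y S := rfl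
  rw [← Function.Bijective.of_comp_iff' (hτ Y), hf, Function.Bijective.of_comp_iff _ (hτ X),
    LinearMap.dualMap_bijective_iff, ← Function.Bijective.of_comp_iff'
      (opLinearEquiv k X S).bijective, hf', Function.Bijective.of_comp_iff _
      (opLinearEquiv k Y S).bijective]

lemma flip_injective (Y : C) : Function.Injective (serrePairing τ Y).flip := by
  rw [injective_iff_map_eq_zero]
  intro h hh
  rw [← Module.forall_dual_apply_eq_zero_iff k, (hτ Y).surjective.forall]
  exact LinearMap.congr_fun hh

lemma postcomp_eq_iff_op {X Y : C} (f g : X ⟶ Y) :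
    postcomp T f = postcomp T g ↔ postcomp (op S) f.op = postcomp (op S) g.op := by
  have h₁ : postcomp T f = postcomp T g ↔
      ∀ (t : T ⟶ X) (h : Y ⟶ S), τ ((t ≫ f) ≫ h) = τ ((t ≫ g) ≫ h) := by
    simp only [LinearMap.ext_iff, ← (hτ Y).injective.eq_iff]
    rfl
  have h₂ : postcomp (op S) f.op = postcomp (op S) g.op ↔
      ∀ (h : Y ⟶ S) (t : T ⟶ X), τ (t ≫ f ≫ h) = τ (t ≫ g ≫ h) := by
    simp only [LinearMap.ext_iff, (opLinearEquiv k Y S).surjective.forall,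
      ← (opLinearEquiv k X S).symm.injective.eq_iff, ← (hτ.flip_injective X).eq_iff]
    rfl
  simp only [h₁, h₂, Category.assoc]
  exact forall_comm

lemma isRigid_op [HasShift C ℤ] [∀ n : ℤ, (shiftFunctor C n).Additive] (hT : IsRigid T) :
    IsRigid (op S) := by
  have h₁ : homKernel (op S) (op (T⟦(1 : ℤ)⟧)) := hτ.homKernel_iff_op.1 hT
  have h₂ : homKernel T (S⟦(-1 : ℤ)⟧) := by
    intro t
    apply (shiftFunctor C (1 : ℤ)).map_injective
    rw [Functor.map_zero, ← cancel_mono ((shiftNegShift S (1 : ℤ)).hom), zero_comp]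
    exact Quiver.Hom.op_inj (h₁ _)
  intro f
  rw [← cancel_mono (((shiftFunctorOpIso C 1 (-1) (by lia)).app (op S)).hom), zero_comp]
  exact hτ.homKernel_iff_op.1 h₂ _

end IsSerreTrace

end Serre

instance isMultiplicative_regularMorphisms (A : Type u) [Category.{v} A] :
    (regularMorphisms A).IsMultiplicative :=
  inferInstanceAs (MorphismProperty.monomorphisms A ⊓
    MorphismProperty.epimorphisms A).IsMultiplicative

section Regular

variable {C : Type u} [Category.{v} C] [Preadditive C] [HasZeroObject C] [HasShift C ℤ]
  [∀ n : ℤ, (shiftFunctor C n).Additive] [Pretriangulated C] {T : C}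
  [∀ X : C, Module.Finite (End T)ᵐᵒᵖ (T ⟶ X)]

lemma proj_map_eq_iff (hT : IsRigid T) {X Y : C} (f g : X ⟶ Y) :
    (proj T).map f = (proj T).map g ↔ postcomp T f = postcomp T g :=
  (CategoryTheory.Quotient.functor_map_eq_iff _ _ _).trans (factorRel_iff hT f g)

lemma mono_proj_map_iff (hT : IsRigid T) {X Y : C} (f : X ⟶ Y) :
    Mono ((proj T).map f) ↔ Function.Injective (postcomp T f) := by
  constructor
  · intro _ s t hst
    apply postcomp_injective T X
    rw [← proj_map_eq_iff hT, ← cancel_mono ((proj T).map f), ← Functor.map_comp,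
      ← Functor.map_comp]
    exact congrArg _ hst
  · refine fun hf => ⟨?_⟩
    rintro ⟨Z⟩ a b hab
    obtain ⟨a, rfl⟩ := (proj T).map_surjective (X := Z) (Y := X) a
    obtain ⟨b, rfl⟩ := (proj T).map_surjective (X := Z) (Y := X) b
    rw [← Functor.map_comp, ← Functor.map_comp, proj_map_eq_iff hT, postcomp_comp,
      postcomp_comp, LinearMap.cancel_left hf] at hab
    exact (proj_map_eq_iff hT a b).2 hab

lemma epi_proj_map_iff (hT : IsRigid T) {X Y : C} (f : X ⟶ Y) :
    Epi ((proj T).map f) ↔ Function.Surjective (postcomp T f) := by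
  constructor
  · intro _ t
    obtain ⟨Z, g, δ, h⟩ := distinguished_cocone_triangle f
    have hfg : f ≫ g = 0 := comp_distTriang_mor_zero₁₂ _ h
    have hg : (proj T).map g = (proj T).map 0 := by
      rw [← cancel_epi ((proj T).map f), ← Functor.map_comp, ← Functor.map_comp, hfg, comp_zero]
    rw [proj_map_eq_iff hT, postcomp_zero] at hg
    exact (exact_postcomp T h t).1 (LinearMap.congr_fun hg t)
  · refine fun hf => ⟨?_⟩
    rintro ⟨Z⟩ a b hab
    obtain ⟨a, rfl⟩ := (proj T).map_surjective (X := Y) (Y := Z) a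
    obtain ⟨b, rfl⟩ := (proj T).map_surjective (X := Y) (Y := Z) b
    rw [← Functor.map_comp, ← Functor.map_comp, proj_map_eq_iff hT, postcomp_comp,
      postcomp_comp, LinearMap.cancel_right hf] at hab
    exact (proj_map_eq_iff hT a b).2 hab

lemma regular_proj_map_iff (hT : IsRigid T) {X Y : C} (f : X ⟶ Y) :
    regular T ((proj T).map f) ↔ Function.Bijective (postcomp T f) :=
  and_congr (mono_proj_map_iff hT f) (epi_proj_map_iff hT f)

lemma hasRightCalculusOfFractions_regular (hT : IsRigid T) :
    (regular T).HasRightCalculusOfFractions where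
  exists_rightFraction := by
    rintro ⟨X⟩ ⟨Y⟩ (@⟨⟨Y'⟩, f, s, hs⟩)
    obtain ⟨f, rfl⟩ := (proj T).map_surjective (X := X) (Y := Y') f
    obtain ⟨s, rfl⟩ := (proj T).map_surjective (X := Y) (Y := Y') s
    obtain ⟨X', r, g, hr, h⟩ := exists_ore_square hT ((regular_proj_map_iff hT s).1 hs) f
    exact ⟨⟨(proj T).map r, (regular_proj_map_iff hT r).2 hr, (proj T).map g⟩,
      (proj_map_eq_iff hT (r ≫ f) (g ≫ s)).2 h⟩
  ext X _ _ _ _ s hs h :=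
    have : Mono s := hs.1
    ⟨X, 𝟙 X, (regular T).id_mem X, by rw [(cancel_mono s).1 h]⟩

omit [∀ X : C, Module.Finite (End T)ᵐᵒᵖ (T ⟶ X)] in
/-- By duality, `Hom(-, S)` and `Hom(T, -)` invert the same morphisms and identify the same
morphisms, so the Ore condition is that of the rigid object `S` of `Cᵒᵖ`. -/
lemma hasLeftCalculusOfFractions_regular {k : Type w} [Field k] [Linear k C]
    [∀ X : C, FiniteDimensional k (T ⟶ X)] (hT : IsRigid T) {S : C} {τ : Module.Dual k (T ⟶ S)}
    (hτ : IsSerreTrace τ) : (regular T).HasLeftCalculusOfFractions where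
  exists_leftFraction := by
    have (X : C) := moduleFinite_hom k T X
    have (X : Cᵒᵖ) : Module.Finite (End (op S))ᵐᵒᵖ (op S ⟶ X) :=
      have := hτ.finiteDimensional_hom_op (Y := X.unop)
      moduleFinite_hom k (op S) X
    rintro ⟨X'⟩ ⟨Y⟩ (@⟨⟨X⟩, s, hs, f⟩)
    obtain ⟨f, rfl⟩ := (proj T).map_surjective (X := X) (Y := Y) f
    obtain ⟨s, rfl⟩ := (proj T).map_surjective (X := X) (Y := X') s
    obtain ⟨Y', r, g, hr, h⟩ := exists_ore_square (hτ.isRigid_op hT)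
      ((hτ.bijective_postcomp_iff_op s).1 ((regular_proj_map_iff hT s).1 hs)) f.op
    exact ⟨⟨(proj T).map g.unop, (proj T).map r.unop,
        (regular_proj_map_iff hT _).2 ((hτ.bijective_postcomp_iff_op _).2 hr)⟩,
      (proj_map_eq_iff hT (f ≫ r.unop) (s ≫ g.unop)).2 ((hτ.postcomp_eq_iff_op _ _).2 h)⟩
  ext _ _ Y _ _ s hs h :=
    have : Epi s := hs.2
    ⟨Y, 𝟙 Y, (regular T).id_mem Y, by rw [(cancel_epi s).1 h]⟩

end Regular

lemma faithful_of_le_epimorphisms {A : Type u} [Category.{v} A] {B : Type u'} [Category.{v'} B]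
    (L : A ⥤ B) (W : MorphismProperty A) [L.IsLocalization W] [W.HasRightCalculusOfFractions]
    (hW : W ≤ MorphismProperty.epimorphisms A) : L.Faithful where
  map_injective {_ _ f g} h := by
    obtain ⟨Z, s, hs, hfg⟩ := (MorphismProperty.map_eq_iff_precomp L W f g).1 h
    have : Epi s := hW s hs
    exact (cancel_epi s).1 hfg

lemma exists_toLoc_obj_eq {C : Type u} [Category.{v} C] [Preadditive C] (T : C) (Y : LocCat T) :
    ∃ X : C, (toLoc T).obj X = Y := by
  obtain ⟨⟨X⟩, rfl⟩ := (Localization.Construction.objEquiv (regular T)).surjective Y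
  exact ⟨X, rfl⟩

section Localisation

variable {C : Type u} [Category.{v} C] [Preadditive C] [HasZeroObject C] [HasShift C ℤ]
  [∀ n : ℤ, (shiftFunctor C n).Additive] [Pretriangulated C] {T : C}
  [∀ X : C, Module.Finite (End T)ᵐᵒᵖ (T ⟶ X)]

lemma localization_faithful (hT : IsRigid T) : (regular T).Q.Faithful :=
  have := hasRightCalculusOfFractions_regular hT
  faithful_of_le_epimorphisms (regular T).Q (regular T) fun _ _ _ hs => hs.2

lemma toLoc_map_eq_iff (hT : IsRigid T) {X Y : C} (f g : X ⟶ Y) :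
    (toLoc T).map f = (toLoc T).map g ↔ postcomp T f = postcomp T g :=
  have := localization_faithful hT
  (regular T).Q.map_injective.eq_iff.trans (proj_map_eq_iff hT f g)

lemma isIso_toLoc_map (hT : IsRigid T) {X Y : C} {s : X ⟶ Y}
    (hs : Function.Bijective (postcomp T s)) : IsIso ((toLoc T).map s) :=
  Localization.inverts (regular T).Q (regular T) _ ((regular_proj_map_iff hT s).2 hs)

lemma surjective_postcomp_of_epi_toLoc_map (hT : IsRigid T) {X Y : C} (f : X ⟶ Y)
    [hf : Epi ((toLoc T).map f)] : Function.Surjective (postcomp T f) :=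
  have := localization_faithful hT
  (epi_proj_map_iff hT f).1 ((regular T).Q.epi_of_epi_map hf)

lemma exists_toLoc_map_comp_eq (hT : IsRigid T) {X Y : C}
    (φ : (toLoc T).obj X ⟶ (toLoc T).obj Y) :
    ∃ (X' : C) (s : X' ⟶ X) (g : X' ⟶ Y), Function.Bijective (postcomp T s) ∧
      (toLoc T).map s ≫ φ = (toLoc T).map g := by
  have := hasRightCalculusOfFractions_regular hT
  obtain ⟨@⟨⟨X'⟩, s, hs, g⟩, rfl⟩ := Localization.exists_rightFraction (regular T).Q (regular T)
    (X := (proj T).obj X) (Y := (proj T).obj Y) φ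
  obtain ⟨s, rfl⟩ := (proj T).map_surjective (X := X') (Y := X) s
  obtain ⟨g, rfl⟩ := (proj T).map_surjective (X := X') (Y := Y) g
  exact ⟨X', s, g, (regular_proj_map_iff hT s).1 hs,
    MorphismProperty.RightFraction.map_s_comp_map
      (⟨(proj T).map s, hs, (proj T).map g⟩ : (regular T).RightFraction _ _) (regular T).Q _⟩

lemma toLoc_map_bijective (hT : IsRigid T) (X : C) :
    Function.Bijective ((toLoc T).map : (T ⟶ X) → _) := by
  constructor
  · exact fun t t' h => postcomp_injective T X ((toLoc_map_eq_iff hT t t').1 h)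
  · intro φ
    obtain ⟨X', s, g, hs, h⟩ := exists_toLoc_map_comp_eq hT φ
    obtain ⟨r, hr : r ≫ s = 𝟙 T⟩ := hs.2 (𝟙 T)
    refine ⟨r ≫ g, ?_⟩
    rw [Functor.map_comp, ← h, ← Category.assoc, ← Functor.map_comp, hr,
      CategoryTheory.Functor.map_id, Category.id_comp]

lemma projective_toLoc_obj (hT : IsRigid T) : Projective ((toLoc T).obj T) where
  factors {X Y} y f _ := by
    obtain ⟨X, rfl⟩ := exists_toLoc_obj_eq T X
    obtain ⟨Y, rfl⟩ := exists_toLoc_obj_eq T Y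
    obtain ⟨X', s, g, hs, h⟩ := exists_toLoc_map_comp_eq hT f
    have := isIso_toLoc_map hT hs
    have : Epi ((toLoc T).map g) := h ▸ epi_comp _ _
    obtain ⟨y, rfl⟩ := (toLoc_map_bijective hT Y).2 y
    obtain ⟨x, rfl⟩ := surjective_postcomp_of_epi_toLoc_map hT g y
    exact ⟨(toLoc T).map (x ≫ s), by
      rw [Functor.map_comp, Category.assoc, h, ← Functor.map_comp, postcomp_apply]⟩

variable [(regular T).HasLeftCalculusOfFractions]

lemma isSeparator_toLoc_obj (hT : IsRigid T) : IsSeparator ((toLoc T).obj T) := by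
  rw [Preadditive.isSeparator_iff]
  intro X Y f hf
  obtain ⟨X, rfl⟩ := exists_toLoc_obj_eq T X
  obtain ⟨Y, rfl⟩ := exists_toLoc_obj_eq T Y
  obtain ⟨X', s, g, hs, h⟩ := exists_toLoc_map_comp_eq hT f
  have := isIso_toLoc_map hT hs
  rw [← cancel_epi ((toLoc T).map s), h, comp_zero, ← (toLoc T).map_zero, toLoc_map_eq_iff hT]
  ext t
  apply (toLoc_map_bijective hT Y).1
  rw [postcomp_zero, LinearMap.zero_apply, postcomp_apply, Functor.map_comp, ← h,
    ← Category.assoc, hf, Functor.map_zero]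

lemma epi_toLoc_map (hT : IsRigid T) {X Y : C} {f : X ⟶ Y}
    (hf : Function.Surjective (postcomp T f)) : Epi ((toLoc T).map f) := by
  refine ⟨fun a b hab => (isSeparator_toLoc_obj hT).def a b fun y => ?_⟩
  obtain ⟨y, rfl⟩ := (toLoc_map_bijective hT Y).2 y
  obtain ⟨x, rfl⟩ := hf y
  rw [postcomp_apply, Functor.map_comp, Category.assoc, hab, Category.assoc]

lemma isProjectiveGenerator_toLoc_obj (hT : IsRigid T) :
    IsProjectiveGenerator ((toLoc T).obj T) where
  projective := projective_toLoc_obj hT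
  exists_epi Y := by
    obtain ⟨X, rfl⟩ := exists_toLoc_obj_eq T Y
    obtain ⟨n, p, hp⟩ := exists_surjective_postcomp T X
    exact ⟨n, (toLoc T).mapBicone (biproduct.bicone fun _ : Fin n => T), (toLoc T).map p,
      ⟨isBilimitOfPreserves (toLoc T) (biproduct.isBilimit _)⟩, epi_toLoc_map hT hp⟩

/-- The isomorphism of `Hom(T, X)` in `C` with the value of `homFunctor` at the image of `X`. -/
noncomputable def homLinearEquiv (hT : IsRigid T) (X : C) :
    (T ⟶ X) ≃ₗ[(End T)ᵐᵒᵖ] (homFunctor (toLoc T) T).obj ((toLoc T).obj X) :=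
  LinearEquiv.ofBijective (M₂ := (homFunctor (toLoc T) T).obj ((toLoc T).obj X))
    { toFun := (toLoc T).map
      map_add' := fun _ _ => (toLoc T).map_add
      map_smul' := fun _ _ => (toLoc T).map_comp _ _ }
    (toLoc_map_bijective hT X)

lemma homLinearEquiv_postcomp (hT : IsRigid T) {X Y : C} (f : X ⟶ Y) :
    (homLinearEquiv hT Y).toLinearMap ∘ₗ postcomp T f =
      ((homFunctor (toLoc T) T).map ((toLoc T).map f)).hom ∘ₗ
        (homLinearEquiv hT X).toLinearMap :=
  LinearMap.ext fun t => (toLoc T).map_comp t f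

lemma homFunctor_faithful (hT : IsRigid T) : (homFunctor (toLoc T) T).Faithful :=
  have := (isSeparator_iff_faithful_preadditiveCoyonedaObj _).1 (isSeparator_toLoc_obj hT)
  Functor.Faithful.comp _ _

lemma homFunctor_full (hT : IsRigid T) : (homFunctor (toLoc T) T).Full where
  map_surjective {X Y} φ := by
    obtain ⟨X, rfl⟩ := exists_toLoc_obj_eq T X
    obtain ⟨Y, rfl⟩ := exists_toLoc_obj_eq T Y
    obtain ⟨X', s, hX', hs⟩ := exists_presentedBy_resolution hT X
    have := isIso_toLoc_map hT hs
    let sφ := (homFunctor (toLoc T) T).map ((toLoc T).map s) ≫ φ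
    obtain ⟨g, hg⟩ := hX'.postcomp_surjective hT Y
      ((homLinearEquiv hT Y).symm.toLinearMap ∘ₗ sφ.hom ∘ₗ (homLinearEquiv hT X').toLinearMap)
    have hgφ : (homFunctor (toLoc T) T).map ((toLoc T).map g) = sφ := by
      ext1
      rw [← LinearMap.cancel_right (homLinearEquiv hT X').surjective, ← homLinearEquiv_postcomp, hg]
      ext t
      simp
    refine ⟨inv ((toLoc T).map s) ≫ (toLoc T).map g, ?_⟩
    rw [← cancel_epi ((homFunctor (toLoc T) T).map ((toLoc T).map s)), ← Functor.map_comp,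
      IsIso.hom_inv_id_assoc, hgφ]

end Localisation

section FinDim

variable {k : Type w} [Field k]

lemma isFinDim_of_linearEquiv {Γ : Type v} [Ring Γ] [Algebra k Γ] {V : Type u} [AddCommGroup V]
    [Module k V] [Module Γ V] [IsScalarTower k Γ V] [FiniteDimensional k V]
    {M : ModuleCat.{v'} Γ} (e : V ≃ₗ[Γ] M) : isFinDim k Γ M :=
  letI : Module k M := ModuleCat.moduleOfAlgebraModule M
  have : IsScalarTower k Γ M := ModuleCat.isScalarTower_of_algebra_moduleCat M
  Module.Finite.equiv (e.restrictScalars k)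

lemma finitePresentation_of_isFinDim {Γ : Type v} [Ring Γ] [Algebra k Γ] [FiniteDimensional k Γ]
    {M : ModuleCat.{v'} Γ} (hM : isFinDim k Γ M) : Module.FinitePresentation Γ M :=
  letI : Module k M := ModuleCat.moduleOfAlgebraModule M
  have : IsScalarTower k Γ M := ModuleCat.isScalarTower_of_algebra_moduleCat M
  have : Module.Finite k M := hM
  have : Module.Finite Γ M := Module.Finite.of_restrictScalars_finite k Γ M
  have : IsNoetherianRing Γ := IsNoetherianRing.of_finite k Γ
  Module.finitePresentation_of_finite Γ M

lemma homFunctorFin_linear {C : Type u} [Category.{v} C] [Preadditive C] [Linear k C]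
    {E : Type u'} [Category.{v'} E] [Preadditive E] [Linear k E] (F : C ⥤ E) [F.Additive]
    [F.Linear k] (T : C) (h : ∀ Y : E, isFinDim k (End T)ᵐᵒᵖ ((homFunctor F T).obj Y)) :
    (homFunctorFin k F T h).Linear k where
  map_smul {X Y} f c := by
    apply (isFinDim k (End T)ᵐᵒᵖ).ι.map_injective
    have hc (x : F.obj T ⟶ X) : x ≫ (c • f) = F.map (c • 𝟙 T) ≫ x ≫ f := by
      rw [Functor.map_smul, CategoryTheory.Functor.map_id, Linear.smul_comp, Category.id_comp,
        Linear.comp_smul]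
    ext x
    exact hc x

variable {C : Type u} [Category.{v} C] [Preadditive C] [Linear k C] [HasZeroObject C]
  [HasShift C ℤ] [∀ n : ℤ, (shiftFunctor C n).Additive] [Pretriangulated C] {T : C}
  [∀ X : C, FiniteDimensional k (T ⟶ X)] [(regular T).HasLeftCalculusOfFractions]

lemma isFinDim_homFunctor_obj (hT : IsRigid T) (Y : LocCat T) :
    isFinDim k (End T)ᵐᵒᵖ ((homFunctor (toLoc T) T).obj Y) := by
  have (X : C) := moduleFinite_hom k T X
  obtain ⟨X, rfl⟩ := exists_toLoc_obj_eq T Y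
  exact isFinDim_of_linearEquiv (homLinearEquiv hT X)

lemma homFunctorFin_isEquivalence (hT : IsRigid T)
    (h : ∀ Y : LocCat T, isFinDim k (End T)ᵐᵒᵖ ((homFunctor (toLoc T) T).obj Y)) :
    (homFunctorFin k (toLoc T) T h).IsEquivalence := by
  have (X : C) := moduleFinite_hom k T X
  have := homFunctor_faithful hT
  have := homFunctor_full hT
  refine { essSurj := ⟨fun M => ?_⟩ }
  have : FiniteDimensional k (End T)ᵐᵒᵖ :=
    Module.Finite.equiv (MulOpposite.opLinearEquiv k : (T ⟶ T) ≃ₗ[k] _)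
  have := finitePresentation_of_isFinDim M.property
  obtain ⟨X, ⟨e⟩⟩ := exists_linearEquiv_hom hT M.obj
  exact ⟨(toLoc T).obj X, ⟨ObjectProperty.isoMk _ ((homLinearEquiv hT X).symm ≪≫ₗ e).toModuleIso⟩⟩

end FinDim

end RigidLoc

theorem theorem5p3_general (k : Type w) [Field k] (C : Type u) [Category.{v} C] [Preadditive C]
    [Linear k C] [HasZeroObject C] [HasShift C ℤ] [∀ n : ℤ, (shiftFunctor C n).Additive]
    [Pretriangulated C] (T S : C) (hfin : ∀ X : C, FiniteDimensional k (T ⟶ X)) (hT : IsRigid T)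
    (τ : Module.Dual k (T ⟶ S)) (hτ : IsSerreTrace τ) :
    (regular T).HasRightCalculusOfFractions ∧
    ∃ _ : (regular T).HasLeftCalculusOfFractions,
      IsProjectiveGenerator ((toLoc T).obj T) ∧
      Function.Bijective (mapEndRingHom (toLoc T) T) ∧
      ∃ hmod : ∀ X : LocCat T, isFinDim k (End T)ᵐᵒᵖ ((homFunctor (toLoc T) T).obj X),
        (homFunctorFin k (toLoc T) T hmod).IsEquivalence ∧
        (homFunctorFin k (toLoc T) T hmod).Linear k := by
  have (X : C) := moduleFinite_hom k T X
  have hleft := hasLeftCalculusOfFractions_regular hT hτ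
  exact ⟨hasRightCalculusOfFractions_regular hT, hleft, isProjectiveGenerator_toLoc_obj hT,
    toLoc_map_bijective hT T, isFinDim_homFunctor_obj hT, homFunctorFin_isEquivalence hT _,
    homFunctorFin_linear _ _ _⟩

theorem theorem5p3 (k : Type w) [Field k]
    (C : Type u) [Category.{v} C] [EssentiallySmall.{v} C]
    [Preadditive C] [Linear k C] [HasZeroObject C] [HasShift C ℤ]
    [∀ n : ℤ, (shiftFunctor C n).Additive] [∀ n : ℤ, (shiftFunctor C n).Linear k]
    [Pretriangulated C] [IsTriangulated C]
    (hfin : IsHomFinite k C) (hKS : IsKrullSchmidt C) (hSerre : Nonempty (SerreDuality k C))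
    (T : C) (hT : IsRigid T) :
    (regular T).HasRightCalculusOfFractions ∧
    ∃ _ : (regular T).HasLeftCalculusOfFractions,
      IsProjectiveGenerator ((toLoc T).obj T) ∧
      Function.Bijective (mapEndRingHom (toLoc T) T) ∧
      ∃ hmod : ∀ X : LocCat T, isFinDim k (End T)ᵐᵒᵖ ((homFunctor (toLoc T) T).obj X),
        (homFunctorFin k (toLoc T) T hmod).IsEquivalence ∧
        (homFunctorFin k (toLoc T) T hmod).Linear k := by
  obtain ⟨D⟩ := hSerre
  exact theorem5p3_general k C T _ (hfin T) hT _ (D.isSerreTrace T)
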